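/- A tiling of the plane by triangles is a family $\mathcal T$ of closed (nondegenerate) triangles in the Euclidean plane that together cover the whole plane and no two of which share an interior point. Let $\mathcal T$ be a tiling of the plane by triangles of unit perimeter, and suppose that there is an $\varepsilon>0$ such that every triangle in $\mathcal T$ has area at least $\varepsilon$. Then there are two distinct triangles in $\mathcal T$ that share a full side, that is, some segment is a side of both of them. -/

import Mathlib

/-- The Euclidean plane. -/
abbrev Plane : Type := EuclideanSpace ℝ (Fin 2)

/-- A (nondegenerate) triangle in the plane, given by its three affinely independent vertices. -/
abbrev PlaneTriangle : Type := Affine.Triangle ℝ Plane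

namespace PlaneTriangle

/-- The closed triangular region with the given vertices. -/
def region (T : PlaneTriangle) : Set Plane := convexHull ℝ (Set.range T.points)

/-- The sum of the three side lengths. -/
noncomputable def perimeter (T : PlaneTriangle) : ℝ :=
  dist (T.points 0) (T.points 1) + dist (T.points 1) (T.points 2) + dist (T.points 2) (T.points 0)

/-- The area, i.e. the planar Lebesgue measure of the closed triangular region. -/
noncomputable def area (T : PlaneTriangle) : ℝ := MeasureTheory.volume.real (region T)

/-- `s` is one of the three (full) sides of `T`. -/
def IsSide (T : PlaneTriangle) (s : Set Plane) : Prop :=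
  ∃ a b : Fin 3, a ≠ b ∧ s = segment ℝ (T.points a) (T.points b)

/-- Some segment is a full side of both triangles. -/
def ShareSide (T T' : PlaneTriangle) : Prop := ∃ s : Set Plane, IsSide T s ∧ IsSide T' s

end PlaneTriangle

/-- A family of closed triangles is a tiling of the plane if its members together cover the plane
and no two members share an interior point. -/
structure IsPlaneTiling {ι : Type*} (T : ι → PlaneTriangle) : Prop where
  covers : ⋃ i, PlaneTriangle.region (T i) = Set.univ
  disjoint_interiors : ∀ i j, i ≠ j →
    Disjoint (interior (PlaneTriangle.region (T i))) (interior (PlaneTriangle.region (T j)))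

open MeasureTheory Filter Topology

/-! Suppose that no two tiles share a side. The area bound makes the tiling locally finite and,
through Heron's formula, keeps all side lengths below some w < 1/2. Let N(R) count the tiles meeting
the closed R-ball. The contradiction is that N grows exponentially, although packing by area allows
only quadratic growth.

Call a side maximal if it is not continued at either end (`IsContinuing`). At each end of a maximal
side of length L, the far side of its line carries a strictly shorter tile side starting there
(`exists_isInner`). The two shorter sides have total length at most L, so together with the maximal
side the three deficits w - length add up to at least 3w - 2L ≥ w. No side is used twice, and the
deficits of one tile add up to 3w - 1. Hence w M(R) ≤ (3w - 1) N(R + 1) for the number M of maximal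
sides (`mul_card_maximalSides_le`).

Every other side has a continued end, at a vertex in the relative interior of some side. The angles
at such a vertex fill a straight angle, as much as one tile has in all, so there are at most N(R +
1) such vertices. Each ends at most two continued sides (`card_continuingEnds_le`). Thus 3N(R) ≤
M(R) + 2N(R + 1), and so 3w N(R) ≤ (5w - 1) N(R + 1), where 5w - 1 < 3w because w < 1/2. -/

theorem Fin.exists_third {a c : Fin 3} (h : a ≠ c) :
    ∃ b : Fin 3, b ≠ a ∧ b ≠ c := by
  revert a c; decide

theorem Fin.eq_or_eq_of_ne {a b c x : Fin 3} (hab : a ≠ b) (hac : a ≠ c) (hbc : b ≠ c)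
    (hx : x ≠ c) : x = a ∨ x = b := by
  revert a b c x; decide

theorem Fin.eq_or_eq_or_eq_of_ne {a b c : Fin 3} (hab : a ≠ b) (hac : a ≠ c) (hbc : b ≠ c)
    (x : Fin 3) : x = a ∨ x = b ∨ x = c := by
  revert a b c x; decide

theorem Fin.sum_three_of_ne {a b c : Fin 3} (hab : a ≠ b) (hac : a ≠ c) (hbc : b ≠ c)
    (f : Fin 3 → ℝ) : ∑ x, f x = f a + f b + f c := by
  have h : (Finset.univ : Finset (Fin 3)) = {a, b, c} := by
    revert a b c; decide
  rw [h, Finset.sum_insert (by simp [hab, hac]), Finset.sum_insert (by simp [hbc]),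
    Finset.sum_singleton]
  ring

theorem AffineMap.apply_lineMap_real {E : Type*} [AddCommGroup E] [Module ℝ E] (g : E →ᵃ[ℝ] ℝ)
    (p q : E) (t : ℝ) : g (AffineMap.lineMap p q t) = (1 - t) * g p + t * g q := by
  rw [AffineMap.apply_lineMap, AffineMap.lineMap_apply_module]
  simp

/-! ### Barycentric coordinates and overlapping triangles -/

namespace PlaneTriangle

/-- The vertices of a triangle as an affine basis of the plane. -/
noncomputable def affineBasis (T : PlaneTriangle) : AffineBasis (Fin 3) ℝ Plane where
  toFun := T.points
  ind' := T.independent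
  tot' := by
    rw [T.independent.affineSpan_eq_top_iff_card_eq_finrank_add_one]
    simp

/-- The barycentric coordinate with respect to the vertex `a`. -/
noncomputable def bary (T : PlaneTriangle) (a : Fin 3) : Plane →ᵃ[ℝ] ℝ := (affineBasis T).coord a

variable {T : PlaneTriangle}

theorem bary_self (T : PlaneTriangle) (a : Fin 3) : bary T a (T.points a) = 1 :=
  (affineBasis T).coord_apply_eq a

theorem bary_of_ne (T : PlaneTriangle) {a b : Fin 3} (h : a ≠ b) : bary T a (T.points b) = 0 :=
  (affineBasis T).coord_apply_ne h

theorem sum_bary (T : PlaneTriangle) (x : Plane) : ∑ a, bary T a x = 1 :=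
  (affineBasis T).sum_coord_apply_eq_one x

theorem bary_ext {x y : Plane} (h : ∀ a, bary T a x = bary T a y) : x = y :=
  (affineBasis T).ext_elem h

theorem mem_region {x : Plane} : x ∈ region T ↔ ∀ a, 0 ≤ bary T a x := by
  have := (affineBasis T).convexHull_eq_nonneg_coord
  exact (Set.ext_iff.1 this x)

theorem mem_interior_region {x : Plane} : x ∈ interior (region T) ↔ ∀ a, 0 < bary T a x := by
  have := (affineBasis T).interior_convexHull
  exact (Set.ext_iff.1 this x)

theorem sum_bary_smul (T : PlaneTriangle) (x : Plane) : ∑ a, bary T a x • T.points a = x :=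
  (affineBasis T).linear_combination_coord_eq_self x

/-- An affine function is determined by its values at the vertices. -/
theorem affine_apply_eq_sum (T : PlaneTriangle) (g : Plane →ᵃ[ℝ] ℝ) (x : Plane) :
    g x = ∑ a, bary T a x * g (T.points a) := by
  conv_lhs => rw [← (affineBasis T).affineCombination_coord_eq_self x]
  have h := (affineBasis T).sum_coord_apply_eq_one x
  rw [Finset.map_affineCombination _ _ _ h,
    Finset.affineCombination_eq_linear_combination _ _ _ h]
  rfl

theorem continuous_bary (T : PlaneTriangle) (a : Fin 3) : Continuous (bary T a) :=
  (bary T a).continuous_of_finiteDimensional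

theorem vertex_mem_region (T : PlaneTriangle) (a : Fin 3) : T.points a ∈ region T :=
  subset_convexHull ℝ _ ⟨a, rfl⟩

theorem convex_region (T : PlaneTriangle) : Convex ℝ (region T) := convex_convexHull ℝ _

theorem isCompact_region (T : PlaneTriangle) : IsCompact (region T) :=
  (Set.finite_range _).isCompact_convexHull ℝ

theorem nonempty_interior_region (T : PlaneTriangle) : (interior (region T)).Nonempty := by
  have := T.independent.affineSpan_eq_top_iff_card_eq_finrank_add_one.2 (by simp)
  exact interior_convexHull_nonempty_iff_affineSpan_eq_top.2 this

/-- The relative interior of the side opposite to the vertex `d`. -/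
def openSide (T : PlaneTriangle) (d : Fin 3) : Set Plane :=
  {x | bary T d x = 0 ∧ ∀ e, e ≠ d → 0 < bary T e x}

theorem openSide_subset_region {d : Fin 3} {x : Plane} (hx : x ∈ openSide T d) :
    x ∈ region T := by
  rw [mem_region]
  intro a
  by_cases h : a = d
  · rw [h, hx.1]
  · exact (hx.2 a h).le

theorem vertex_notMem_openSide (T : PlaneTriangle) (a d : Fin 3) : T.points a ∉ openSide T d := by
  rintro ⟨h1, h2⟩
  by_cases h : a = d
  · rw [h, bary_self] at h1
    norm_num at h1
  · obtain ⟨b, hba, hbd⟩ := Fin.exists_third h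
    have := h2 b hbd
    rw [bary_of_ne T hba] at this
    exact lt_irrefl _ this

theorem openSide_index_unique {x : Plane} {d e : Fin 3} (h : x ∈ openSide T d)
    (h' : x ∈ openSide T e) : d = e := by
  by_contra hne
  have := h'.2 d hne
  rw [h.1] at this
  exact lt_irrefl _ this

/-- An affine function vanishing at the ends of a side is a multiple of the corresponding
barycentric coordinate. -/
theorem eq_mul_bary {c : Fin 3} {g : Plane →ᵃ[ℝ] ℝ} (hg : ∀ x, x ≠ c → g (T.points x) = 0)
    (y : Plane) : g y = g (T.points c) * bary T c y := by
  rw [affine_apply_eq_sum T g y, Finset.sum_eq_single c, mul_comm]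
  · intro b _ hb
    rw [hg b hb, mul_zero]
  · simp

/-- Two triangles overlap if some point common to both can be moved inside the first one in a
direction that leads into the interior of the second one. -/
theorem not_disjoint_interior {S T : PlaneTriangle} {x y : Plane} (hxS : x ∈ region S)
    (hxT : x ∈ region T) (hy : y ∈ region S) (hyT : ∀ e, bary T e x = 0 → 0 < bary T e y) :
    ¬ Disjoint (interior (region S)) (interior (region T)) := by
  obtain ⟨z, hz⟩ := nonempty_interior_region S
  -- Moving `y` slightly towards an interior point `z` of `S` keeps the strict inequalities;
  -- afterwards the direction points into the interior of both triangles.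
  have h1 : ∀ᶠ s : ℝ in 𝓝[>] 0, ∀ e, bary T e x = 0 → 0 < bary T e (AffineMap.lineMap y z s) := by
    rw [eventually_all]
    intro e
    by_cases he : bary T e x = 0
    · have hc : Continuous fun s : ℝ => bary T e (AffineMap.lineMap y z s) :=
        (continuous_bary T e).comp AffineMap.lineMap_continuous
      have : ∀ᶠ s in 𝓝 (0 : ℝ), 0 < bary T e (AffineMap.lineMap y z s) :=
        hc.continuousAt.eventually (lt_mem_nhds (by simpa using hyT e he))
      exact (this.filter_mono nhdsWithin_le_nhds).mono fun s hs _ => hs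
    · exact Eventually.of_forall fun s h => absurd h he
  obtain ⟨s, hs, hs01⟩ := (h1.and (Ioo_mem_nhdsGT (zero_lt_one' ℝ))).exists
  set y' := AffineMap.lineMap y z s with hy'
  have hy'S : y' ∈ interior (region S) :=
    (convex_region S).openSegment_self_interior_subset_interior hy hz
      (openSegment_eq_image_lineMap ℝ y z ▸ ⟨s, hs01, rfl⟩)
  -- A coordinate vanishing at `x` grows at once towards `y'`; one positive at `x` stays positive
  -- for a short time.
  have h2 : ∀ᶠ t : ℝ in 𝓝[>] 0, ∀ e, 0 < bary T e (AffineMap.lineMap x y' t) := by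
    rw [eventually_all]
    intro e
    by_cases he : bary T e x = 0
    · filter_upwards [self_mem_nhdsWithin] with t ht
      rw [AffineMap.apply_lineMap_real, he]
      have := mul_pos (Set.mem_Ioi.1 ht) (hs e he)
      linarith
    · have hc : Continuous fun t : ℝ => bary T e (AffineMap.lineMap x y' t) :=
        (continuous_bary T e).comp AffineMap.lineMap_continuous
      have h0 : 0 < bary T e x := lt_of_le_of_ne (mem_region.1 hxT e) (Ne.symm he)
      have : ∀ᶠ t in 𝓝 (0 : ℝ), 0 < bary T e (AffineMap.lineMap x y' t) :=
        hc.continuousAt.eventually (lt_mem_nhds (by simpa using h0))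
      exact this.filter_mono nhdsWithin_le_nhds
  obtain ⟨t, ht, ht01⟩ := (h2.and (Ioo_mem_nhdsGT (zero_lt_one' ℝ))).exists
  rw [Set.not_disjoint_iff]
  exact ⟨AffineMap.lineMap x y' t, (convex_region S).openSegment_self_interior_subset_interior hxS
    hy'S (openSegment_eq_image_lineMap ℝ x y' ▸ ⟨t, ht01, rfl⟩), mem_interior_region.2 ht⟩

/-! ### Side lengths, area and Heron's formula -/

/-- The length of the side opposite to the vertex `c`. -/
noncomputable def sideLength (T : PlaneTriangle) (c : Fin 3) : ℝ :=
  dist (T.points (c + 1)) (T.points (c + 2))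

theorem sideLength_eq {a b c : Fin 3} (hab : a ≠ b) (hac : a ≠ c) (hbc : b ≠ c) :
    sideLength T c = dist (T.points a) (T.points b) := by
  have h : (a = c + 1 ∧ b = c + 2) ∨ (a = c + 2 ∧ b = c + 1) := by
    revert a b c; decide
  rcases h with ⟨rfl, rfl⟩ | ⟨rfl, rfl⟩
  · rfl
  · rw [dist_comm]; rfl

theorem sum_sideLength (T : PlaneTriangle) : ∑ c, sideLength T c = perimeter T := by
  simp only [Fin.sum_univ_three, sideLength, perimeter]
  have h1 : (1 : Fin 3) + 1 = 2 := rfl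
  have h2 : (1 : Fin 3) + 2 = 0 := rfl
  have h3 : (2 : Fin 3) + 1 = 0 := rfl
  have h4 : (2 : Fin 3) + 2 = 1 := rfl
  rw [h1, h2, h3, h4, zero_add, zero_add]
  ring

theorem sideLength_pos (T : PlaneTriangle) (c : Fin 3) : 0 < sideLength T c := by
  refine dist_pos.2 fun h => ?_
  exact absurd (T.independent.injective h) (by clear h; revert c; decide)

theorem sideLength_le_half {c : Fin 3} (h : perimeter T = 1) : sideLength T c ≤ 1 / 2 := by
  have hs := sum_sideLength T
  have hne : c ≠ c + 1 ∧ c ≠ c + 2 ∧ c + 1 ≠ c + 2 := by revert c; decide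
  have := Fin.sum_three_of_ne hne.1 hne.2.1 hne.2.2 (sideLength T)
  have h1 : sideLength T (c + 1) = dist (T.points (c + 2)) (T.points c) :=
    sideLength_eq hne.2.1.symm hne.2.2.symm hne.1
  have h2 : sideLength T (c + 2) = dist (T.points c) (T.points (c + 1)) :=
    sideLength_eq hne.1 hne.2.1 hne.2.2
  have h3 := dist_triangle_left (T.points (c + 1)) (T.points (c + 2)) (T.points c)
  rw [dist_comm (T.points c) (T.points (c + 2))] at h3
  have h0 : sideLength T c = dist (T.points (c + 1)) (T.points (c + 2)) := rfl
  linarith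

theorem dist_le_half (h : perimeter T = 1) {x y : Plane} (hx : x ∈ region T) (hy : y ∈ region T) :
    dist x y ≤ 1 / 2 := by
  obtain ⟨p, ⟨a, rfl⟩, q, ⟨b, rfl⟩, hpq⟩ := convexHull_exists_dist_ge2 hx hy
  refine hpq.trans ?_
  by_cases hab : a = b
  · rw [hab, dist_self]; norm_num
  · obtain ⟨c, hca, hcb⟩ := Fin.exists_third hab
    rw [← sideLength_eq hab hca.symm hcb.symm]
    exact sideLength_le_half h

/-- Twice the signed area of the triangle. -/
noncomputable def doubleArea (T : PlaneTriangle) : ℝ :=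
  (T.points 1 0 - T.points 0 0) * (T.points 2 1 - T.points 0 1) -
    (T.points 1 1 - T.points 0 1) * (T.points 2 0 - T.points 0 0)

/-- The triangle is an affine image, with determinant `doubleArea`, of a set of coordinate pairs
inside the disc of radius 2. The crude constant suffices, since only a positive lower bound for
`|doubleArea T|` is needed. -/
theorem area_le (T : PlaneTriangle) :
    area T ≤ |doubleArea T| * volume.real (Metric.closedBall (0 : Plane) 2) := by
  let B := (EuclideanSpace.basisFun (Fin 2) ℝ).toBasis
  let M : Matrix (Fin 2) (Fin 2) ℝ :=
    !![T.points 1 0 - T.points 0 0, T.points 2 0 - T.points 0 0;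
      T.points 1 1 - T.points 0 1, T.points 2 1 - T.points 0 1]
  let A : Plane →ₗ[ℝ] Plane := Matrix.toLin B B M
  have hdet : LinearMap.det A = doubleArea T := by
    rw [LinearMap.det_toLin, Matrix.det_fin_two_of, doubleArea]
    ring
  have hsub : region T ⊆ (fun x => T.points 0 + x) '' (A '' Metric.closedBall (0 : Plane) 2) := by
    intro x hx
    have h := mem_region.1 hx
    have hs := sum_bary T x
    have hx' := sum_bary_smul T x
    rw [Fin.sum_univ_three] at hs hx'
    have h0 := h 0
    have h1 := h 1
    have h2 := h 2
    refine ⟨A !₂[bary T 1 x, bary T 2 x], ⟨_, ?_, rfl⟩, ?_⟩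
    · rw [mem_closedBall_zero_iff, EuclideanSpace.norm_eq, Fin.sum_univ_two]
      refine Real.sqrt_le_iff.2 ⟨by norm_num, ?_⟩
      simp only [Real.norm_eq_abs, sq_abs, Matrix.cons_val_zero, Matrix.cons_val_one]
      nlinarith
    · have e0 : bary T 0 x = 1 - bary T 1 x - bary T 2 x := by linarith
      rw [e0] at hx'
      ext k
      have hk := congrArg (fun v : Plane => v k) hx'
      simp only [A, Matrix.toLin_apply, B, M, Fin.sum_univ_two, Matrix.mulVec, dotProduct]
      fin_cases k <;> simp at hk ⊢ <;> linarith
  have hvol : volume (region T) ≤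
      ENNReal.ofReal |doubleArea T| * volume (Metric.closedBall (0 : Plane) 2) := by
    refine (measure_mono hsub).trans ?_
    rw [Set.image_add_left, measure_preimage_add, Measure.addHaar_image_linearMap, hdet]
  rw [area, Measure.real, Measure.real]
  refine (ENNReal.toReal_mono ?_ hvol).trans ?_
  · exact ENNReal.mul_ne_top ENNReal.ofReal_ne_top measure_closedBall_lt_top.ne
  · rw [ENNReal.toReal_mul, ENNReal.toReal_ofReal (abs_nonneg _)]

/-- Heron's formula for unit perimeter. -/
theorem four_mul_doubleArea_sq (h : perimeter T = 1) :
    4 * doubleArea T ^ 2 =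
      (1 - 2 * sideLength T 0) * (1 - 2 * sideLength T 1) * (1 - 2 * sideLength T 2) := by
  have hs := sum_sideLength T
  rw [h, Fin.sum_univ_three] at hs
  have key : ∀ p q : Plane, dist p q ^ 2 = (p 0 - q 0) ^ 2 + (p 1 - q 1) ^ 2 := by
    intro p q
    rw [EuclideanSpace.dist_eq, Real.sq_sqrt (by positivity), Fin.sum_univ_two]
    simp only [Real.dist_eq, sq_abs]
  have h0 := key (T.points 1) (T.points 2)
  have h1 := key (T.points 2) (T.points 0)
  have h2 := key (T.points 0) (T.points 1)
  have e0 : sideLength T 0 = dist (T.points 1) (T.points 2) := rfl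
  have e1 : sideLength T 1 = dist (T.points 2) (T.points 0) := rfl
  have e2 : sideLength T 2 = dist (T.points 0) (T.points 1) := rfl
  rw [← e0] at h0
  rw [← e1] at h1
  rw [← e2] at h2
  generalize sideLength T 0 = a at *
  generalize sideLength T 1 = b at *
  generalize sideLength T 2 = c at *
  have e : (1 - 2 * a) * (1 - 2 * b) * (1 - 2 * c) =
      4 * (b ^ 2 * c ^ 2) - (b ^ 2 + c ^ 2 - a ^ 2) ^ 2 := by
    have ha : a = 1 - b - c := by linarith
    subst ha
    ring
  rw [e, h0, h1, h2, doubleArea]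
  ring

/-- All three factors in Heron's formula lie in [0, 1], so each is at least their product, which the
area bounds from below. This gives a uniform gap below 1/2. -/
theorem sideLength_le_of_area {ε : ℝ} (hε : 0 < ε) (h : perimeter T = 1) (hA : ε ≤ area T)
    (c : Fin 3) :
    sideLength T c ≤ 1 / 2 - 2 * (ε / volume.real (Metric.closedBall (0 : Plane) 2)) ^ 2 := by
  set K := volume.real (Metric.closedBall (0 : Plane) 2) with hK
  have hKpos : 0 < K := by
    have : 0 ≤ K := measureReal_nonneg
    refine lt_of_le_of_ne this fun h0 => ?_
    have := hA.trans (area_le T)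
    rw [← hK, ← h0, mul_zero] at this
    linarith
  have h1 : ε / K ≤ |doubleArea T| := (div_le_iff₀ hKpos).2 (hA.trans (area_le T))
  have h2 : (ε / K) ^ 2 ≤ doubleArea T ^ 2 := by
    rw [← sq_abs (doubleArea T)]
    gcongr
  have h3 := four_mul_doubleArea_sq h
  have l : ∀ c, 0 ≤ 1 - 2 * sideLength T c ∧ 1 - 2 * sideLength T c ≤ 1 := fun c =>
    ⟨by linarith [sideLength_le_half (c := c) h], by linarith [sideLength_pos T c]⟩
  have h4 : (1 - 2 * sideLength T 0) * (1 - 2 * sideLength T 1) * (1 - 2 * sideLength T 2) ≤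
      1 - 2 * sideLength T c := by
    obtain ⟨a0, a1⟩ := l 0
    obtain ⟨b0, b1⟩ := l 1
    obtain ⟨c0, c1⟩ := l 2
    have hab := mul_nonneg a0 b0
    obtain rfl | rfl | rfl : c = 0 ∨ c = 1 ∨ c = 2 := by revert c; decide
    · exact (mul_le_of_le_one_right hab c1).trans (mul_le_of_le_one_right a0 b1)
    · exact (mul_le_of_le_one_right hab c1).trans (mul_le_of_le_one_left b0 a1)
    · exact mul_le_of_le_one_left c0 (mul_le_one₀ a1 b0 b1)
  linarith

end PlaneTriangle

/-! ### Points on the sides of a triangle -/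

namespace PlaneTriangle

variable {T : PlaneTriangle}

theorem bary_lineMap_vertices {a b c : Fin 3} (hab : a ≠ b) (hac : a ≠ c) (hbc : b ≠ c) (t : ℝ) :
    bary T a (AffineMap.lineMap (T.points a) (T.points b) t) = 1 - t ∧
    bary T b (AffineMap.lineMap (T.points a) (T.points b) t) = t ∧
    bary T c (AffineMap.lineMap (T.points a) (T.points b) t) = 0 := by
  simp only [AffineMap.apply_lineMap_real, bary_self, bary_of_ne T hab, bary_of_ne T hab.symm,
    bary_of_ne T hac.symm, bary_of_ne T hbc.symm]
  refine ⟨?_, ?_, ?_⟩ <;> ring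

theorem lineMap_mem_openSide {a b c : Fin 3} (hab : a ≠ b) (hac : a ≠ c) (hbc : b ≠ c) {t : ℝ}
    (h0 : 0 < t) (h1 : t < 1) : AffineMap.lineMap (T.points a) (T.points b) t ∈ openSide T c := by
  obtain ⟨ha, hb, hc⟩ := bary_lineMap_vertices (T := T) hab hac hbc t
  refine ⟨hc, fun e he => ?_⟩
  obtain rfl | rfl := Fin.eq_or_eq_of_ne hab hac hbc he
  · linarith
  · linarith

theorem eq_lineMap_of_bary_eq_zero {a b c : Fin 3} (hab : a ≠ b) (hac : a ≠ c) (hbc : b ≠ c)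
    {x : Plane} (hx : bary T c x = 0) :
    x = AffineMap.lineMap (T.points a) (T.points b) (bary T b x) := by
  obtain ⟨ha, hb, hc⟩ := bary_lineMap_vertices (T := T) hab hac hbc (bary T b x)
  have hs := sum_bary T x
  rw [Fin.sum_three_of_ne hab hac hbc] at hs
  refine bary_ext (T := T) fun e => ?_
  obtain rfl | rfl | rfl := Fin.eq_or_eq_or_eq_of_ne hab hac hbc e
  · linarith
  · linarith
  · linarith

theorem eq_vertex_of_bary {a b c : Fin 3} (hab : a ≠ b) (hac : a ≠ c) (hbc : b ≠ c)
    {x : Plane} (hb : bary T b x = 0) (hc : bary T c x = 0) : x = T.points a := by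
  rw [eq_lineMap_of_bary_eq_zero hab hac hbc hc, hb, AffineMap.lineMap_apply_zero]

/-- A barycentric coordinate of a triangle does not vanish at all vertices of another one. -/
theorem exists_bary_vertex_ne_zero (S T : PlaneTriangle) (c : Fin 3) :
    ∃ d, bary T c (S.points d) ≠ 0 := by
  by_contra! h
  have := affine_apply_eq_sum S (bary T c) (T.points c)
  simp [h, bary_self] at this

theorem midpoint_mem_openSide {a c : Fin 3} (hac : a ≠ c) {y : Plane} (hy : y ∈ openSide T c) :
    midpoint ℝ (T.points a) y ∈ openSide T c := by
  have key : ∀ e, bary T e (midpoint ℝ (T.points a) y) =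
      (1 - 1 / 2) * bary T e (T.points a) + 1 / 2 * bary T e y := by
    intro e
    rw [← AffineMap.apply_lineMap_real, midpoint]
    norm_num
  refine ⟨?_, fun e he => ?_⟩
  · rw [key, hy.1, bary_of_ne T hac.symm]
    ring
  · rw [key]
    have h1 := hy.2 e he
    have h2 := mem_region.1 (vertex_mem_region T a) e
    linarith

end PlaneTriangle

/-! ### Tiles touching along a side -/

namespace IsPlaneTiling

open PlaneTriangle

variable {ι : Type*} {T : ι → PlaneTriangle}

/-- The indices of the tiles that meet the closed ball of radius `R` about the origin. -/
def near (T : ι → PlaneTriangle) (R : ℝ) : Set ι :=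
  {i | (region (T i) ∩ Metric.closedBall 0 R).Nonempty}

theorem eq_of_common_direction (hT : IsPlaneTiling T) {i j : ι} {x y : Plane}
    (hxi : x ∈ region (T i)) (hxj : x ∈ region (T j)) (hy : y ∈ region (T i))
    (h : ∀ e, bary (T j) e x = 0 → 0 < bary (T j) e y) : i = j := by
  by_contra hne
  exact not_disjoint_interior hxi hxj hy h (hT.disjoint_interiors i j hne)

/-- A tile touching another one in a relatively interior point of a side lies beyond the line of
that side. -/
theorem bary_nonpos (hT : IsPlaneTiling T) {i j : ι} (hij : i ≠ j) {d : Fin 3} {x y : Plane}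
    (hx : x ∈ openSide (T j) d) (hxi : x ∈ region (T i)) (hy : y ∈ region (T i)) :
    bary (T j) d y ≤ 0 := by
  by_contra! h
  refine hij (hT.eq_of_common_direction hxi (openSide_subset_region hx) hy fun e he => ?_)
  by_cases hed : e = d
  · rwa [hed]
  · exact absurd he (hx.2 e hed).ne'

/-- Pigeonhole: near `x` only finitely many tiles compete, so one of them is hit frequently, and
being closed it contains the limit. -/
theorem exists_frequently_mem (hF : ∀ R, (near T R).Finite) {α : Type*} {l : Filter α} [l.NeBot]
    {u : α → Plane} {x : Plane} (hu : Tendsto u l (𝓝 x)) {Q : ι → Prop}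
    (hQ : ∀ᶠ n in l, ∃ j, Q j ∧ u n ∈ region (T j)) :
    ∃ j, Q j ∧ x ∈ region (T j) ∧ ∃ᶠ n in l, u n ∈ region (T j) := by
  by_contra! hcon
  have h1 : ∀ j, Q j → ∀ᶠ n in l, u n ∉ region (T j) := by
    intro j hj
    by_contra hf
    rw [not_eventually] at hf
    simp only [not_not] at hf
    exact hf (hcon j hj
      ((isCompact_region (T j)).isClosed.mem_of_frequently_of_tendsto hf hu))
  have h2 : ∀ᶠ n in l, ∀ j ∈ near T (‖x‖ + 1), Q j → u n ∉ region (T j) := by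
    rw [eventually_all_finite (hF _)]
    intro j _
    by_cases hj : Q j
    · exact (h1 j hj).mono fun n hn _ => hn
    · exact Eventually.of_forall fun n h => absurd h hj
  have h3 : ∀ᶠ n in l, ‖u n‖ < ‖x‖ + 1 :=
    hu.norm.eventually (gt_mem_nhds (lt_add_one _))
  obtain ⟨n, ⟨j, hj, hn⟩, h, hlt⟩ := (hQ.and (h2.and h3)).exists
  exact h j ⟨u n, hn, mem_closedBall_zero_iff.2 hlt.le⟩ hj hn

theorem exists_mem_region (hT : IsPlaneTiling T) (x : Plane) : ∃ j, x ∈ region (T j) := by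
  have : x ∈ ⋃ i, region (T i) := hT.covers ▸ Set.mem_univ x
  simpa using this

theorem tendsto_lineMap_zero (x y : Plane) :
    Tendsto (fun t : ℝ => AffineMap.lineMap x y t) (𝓝[>] 0) (𝓝 x) := by
  have hc : Continuous fun t : ℝ => AffineMap.lineMap (k := ℝ) x y t := AffineMap.lineMap_continuous
  have := hc.tendsto 0
  simp only [AffineMap.lineMap_apply_zero] at this
  exact this.mono_left nhdsWithin_le_nhds

/-- Beyond a relatively interior point of a side there is another tile. -/
theorem exists_opposite (hT : IsPlaneTiling T) (hF : ∀ R, (near T R).Finite) {i : ι} {c : Fin 3}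
    {x : Plane} (hx : x ∈ openSide (T i) c) : ∃ j, j ≠ i ∧ x ∈ region (T j) := by
  -- The parameter -1 reflects the vertex `c` in `x`, so the approach to `x` is from outside tile
  -- `i`.
  have hu := tendsto_lineMap_zero x (AffineMap.lineMap x ((T i).points c) (-1 : ℝ))
  obtain ⟨j, hj, hxj, -⟩ := exists_frequently_mem hF hu (Q := fun j => j ≠ i) (by
    filter_upwards [self_mem_nhdsWithin] with t ht
    obtain ⟨j, hj⟩ := hT.exists_mem_region
      (AffineMap.lineMap x (AffineMap.lineMap x ((T i).points c) (-1 : ℝ)) t)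
    refine ⟨j, ?_, hj⟩
    rintro rfl
    have := mem_region.1 hj c
    simp only [AffineMap.apply_lineMap_real, hx.1, bary_self] at this
    have ht' : 0 < t := ht
    linarith)
  exact ⟨j, hj, hxj⟩

/-- Two tiles lying on the same side of a common line, with overlapping sides on that line,
are equal. -/
theorem eq_of_same_side (hT : IsPlaneTiling T) {i i' : ι} {c c' : Fin 3} {g : Plane →ᵃ[ℝ] ℝ}
    (hg : ∀ x, x ≠ c → g ((T i).points x) = 0) (hneg : g ((T i).points c) < 0)
    (hneg' : g ((T i').points c') < 0) {z : Plane} (hz : z ∈ openSide (T i) c)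
    (hz' : z ∈ openSide (T i') c') : i = i' ∧ c = c' := by
  have hi : i = i' := by
    by_contra hne
    have h1 := hT.bary_nonpos (Ne.symm hne) hz (openSide_subset_region hz')
      (vertex_mem_region (T i') c')
    have h2 := eq_mul_bary hg ((T i').points c')
    have h3 := mul_nonneg_of_nonpos_of_nonpos hneg.le h1
    linarith
  subst hi
  exact ⟨rfl, openSide_index_unique hz hz'⟩

/-! ### Continued sides and inner sides -/

/-- The side of the tile `i` opposite to its vertex `c` is continued beyond its end `a` by a side
of another tile having this end in its relative interior. -/
def IsContinuing (T : ι → PlaneTriangle) (i : ι) (c a : Fin 3) : Prop :=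
  a ≠ c ∧ ∃ j d, (T i).points a ∈ openSide (T j) d ∧
    ∀ x, x ≠ c → bary (T j) d ((T i).points x) = 0

/-- The side `(j, d)` lies inside the side `(i, c)`, on its other side, starts at the end `a` of
the latter and is shorter. -/
def IsInner (T : ι → PlaneTriangle) (i : ι) (c a : Fin 3) (j : ι) (d : Fin 3) : Prop :=
  (∀ x, x ≠ d → bary (T i) c ((T j).points x) = 0) ∧ bary (T i) c ((T j).points d) < 0 ∧
    ∃ e f, e ≠ d ∧ f ≠ d ∧ e ≠ f ∧ (T j).points e = (T i).points a ∧
      (T j).points f ∈ openSide (T i) c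

/-- Its second end lies inside the longer side, which continues it. Hence an inner side is never
maximal. -/
theorem IsInner.isContinuing {i : ι} {c a : Fin 3} {j : ι} {d : Fin 3}
    (h : IsInner T i c a j d) : ∃ f, IsContinuing T j d f := by
  obtain ⟨h1, -, e, f, -, hf, -, -, h2⟩ := h
  exact ⟨f, hf, i, c, h2, h1⟩

/-- Some tile across the side contains its end `a` and points of the side arbitrarily close to `a`.
One of its sides therefore runs along the line; it cannot extend past either end, since nothing
continues the given side, and it cannot coincide with that side. -/
theorem exists_isInner (hT : IsPlaneTiling T) (hF : ∀ R, (near T R).Finite)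
    (hshare : ∀ i j, i ≠ j → ¬ ShareSide (T i) (T j)) {i : ι} {c a : Fin 3} (hac : a ≠ c)
    (hend : ∀ a, ¬ IsContinuing T i c a) : ∃ j d, IsInner T i c a j d := by
  obtain ⟨b, hba, hbc⟩ := Fin.exists_third hac
  have hab := hba.symm
  set p := (T i).points a with hp
  set q := (T i).points b with hq
  have hmem : ∀ t : ℝ, 0 < t → t < 1 → AffineMap.lineMap p q t ∈ openSide (T i) c :=
    fun t h0 h1 => lineMap_mem_openSide hab hac hbc h0 h1
  obtain ⟨j, hji, hpj, hfreq⟩ := exists_frequently_mem hF (tendsto_lineMap_zero p q)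
    (Q := fun j => j ≠ i) (by
      filter_upwards [Ioo_mem_nhdsGT (zero_lt_one' ℝ)] with t ht
      exact hT.exists_opposite hF (hmem t ht.1 ht.2))
  obtain ⟨t, hmj, ht0, ht1⟩ := (hfreq.and_eventually (Ioo_mem_nhdsGT (zero_lt_one' ℝ))).exists
  have hm := hmem t ht0 ht1
  set m := AffineMap.lineMap p q t with hmdef
  have hle : ∀ y ∈ region (T j), bary (T i) c y ≤ 0 := fun y hy => hT.bary_nonpos hji hm hmj hy
  -- Tile `j` lies beyond the line, so zero at `x` is a combination of nonpositive terms, each of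
  -- which must vanish.
  have hzero : ∀ x ∈ region (T j), bary (T i) c x = 0 →
      ∀ e, bary (T j) e x * bary (T i) c ((T j).points e) = 0 := by
    intro x hx hx0 e
    have hsum := affine_apply_eq_sum (T j) (bary (T i) c) x
    rw [hx0] at hsum
    exact (Finset.sum_eq_zero_iff_of_nonpos fun e _ => mul_nonpos_of_nonneg_of_nonpos
      (mem_region.1 hx e) (hle _ (vertex_mem_region _ _))).1 hsum.symm e (Finset.mem_univ e)
  have hp0 : bary (T i) c p = 0 := bary_of_ne _ hac.symm
  have hq0 : bary (T i) c q = 0 := bary_of_ne _ hbc.symm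
  have hbm := (bary_lineMap_vertices (T := T i) hab hac hbc t).2.1
  rw [← hp, ← hq, ← hmdef] at hbm
  have hpm : p ≠ m := by
    intro h
    rw [← h, hp, bary_of_ne _ hba] at hbm
    exact ht0.ne hbm
  obtain ⟨d, hd⟩ := exists_bary_vertex_ne_zero (T j) (T i) c
  have hdneg : bary (T i) c ((T j).points d) < 0 :=
    lt_of_le_of_ne (hle _ (vertex_mem_region _ _)) hd
  have hpd : bary (T j) d p = 0 := (mul_eq_zero.1 (hzero p hpj hp0 d)).resolve_right hd
  have hmd : bary (T j) d m = 0 := (mul_eq_zero.1 (hzero m hmj hm.1 d)).resolve_right hd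
  -- With two vertices off the line, tile `j` would meet the line only in its third vertex, yet it
  -- contains both `p` and `m`.
  have hline : ∀ x, x ≠ d → bary (T i) c ((T j).points x) = 0 := by
    intro x hx
    by_contra hne
    obtain ⟨y, hyx, hyd⟩ := Fin.exists_third hx
    have h1 := (mul_eq_zero.1 (hzero p hpj hp0 x)).resolve_right hne
    have h2 := (mul_eq_zero.1 (hzero m hmj hm.1 x)).resolve_right hne
    exact hpm ((eq_vertex_of_bary hyx hyd hx h1 hpd).trans
      (eq_vertex_of_bary hyx hyd hx h2 hmd).symm)
  have hline' : ∀ y, bary (T i) c y = 0 → bary (T j) d y = 0 := by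
    intro y hy
    rw [eq_mul_bary hline y] at hy
    exact (mul_eq_zero.1 hy).resolve_left hd
  have hcont : ∀ x, x ≠ c → bary (T j) d ((T i).points x) = 0 := fun x hx =>
    hline' _ (bary_of_ne _ hx.symm)
  have hpn : p ∉ openSide (T j) d := fun h => hend a ⟨hac, j, d, h, hcont⟩
  have hqn : q ∉ openSide (T j) d := fun h => hend b ⟨hbc, j, d, h, hcont⟩
  obtain ⟨f, hfd, hfp⟩ : ∃ f, f ≠ d ∧ bary (T j) f p = 0 := by
    by_contra! h
    exact hpn ⟨hpd, fun e he => lt_of_le_of_ne (mem_region.1 hpj e) (h e he).symm⟩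
  obtain ⟨e, hef, hed⟩ := Fin.exists_third hfd
  have hpe : p = (T j).points e := eq_vertex_of_bary hef hed hfd hfp hpd
  refine ⟨j, d, hline, hdneg, e, f, hed, hfd, hef, hpe.symm, ?_⟩
  have hf0 := hline f hfd
  have hfτ := eq_lineMap_of_bary_eq_zero hab hac hbc hf0
  set τ := bary (T i) b ((T j).points f) with hτ
  have hms := eq_lineMap_of_bary_eq_zero hef hed hfd hmd
  have hs0 : 0 ≤ bary (T j) f m := mem_region.1 hmj f
  have hτpos : 0 < τ := by
    have h := congrArg (bary (T i) b) hms
    rw [hbm, AffineMap.apply_lineMap_real, ← hpe, hp, bary_of_ne _ hba, ← hτ] at h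
    by_contra! hle
    have := mul_nonpos_of_nonneg_of_nonpos hs0 hle
    linarith
  have hbary : ∀ x, bary (T j) x ((T j).points f) =
      (1 - τ) * bary (T j) x p + τ * bary (T j) x q := by
    intro x
    conv_lhs => rw [hfτ]
    rw [AffineMap.apply_lineMap_real]
  have hτlt : τ < 1 := by
    -- At τ = 1 the tiles share the full side; for τ > 1 the end `q` lies inside the side of `j`,
    -- which would continue the given side.
    rcases lt_trichotomy τ 1 with h | h | h
    · exact h
    · rw [h, AffineMap.lineMap_apply_one] at hfτ
      refine absurd ⟨segment ℝ p q, ⟨a, b, hab, rfl⟩, e, f, hef, ?_⟩ (hshare i j hji.symm)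
      rw [← hpe, hfτ]
    · refine absurd ⟨hline' q hq0, fun x hx => ?_⟩ hqn
      rcases Fin.eq_or_eq_of_ne hef hed hfd hx with rfl | rfl
      · have := hbary x
        rw [bary_of_ne _ hef, hpe, bary_self] at this
        by_contra! hle
        have := mul_nonpos_of_nonneg_of_nonpos hτpos.le hle
        linarith
      · have := hbary x
        rw [bary_self, hfp] at this
        by_contra! hle
        have := mul_nonpos_of_nonneg_of_nonpos hτpos.le hle
        linarith
  rw [hfτ]
  exact hmem τ hτpos hτlt

theorem IsInner.exists_lineMap {i : ι} {a b c : Fin 3} (hab : a ≠ b) (hac : a ≠ c) (hbc : b ≠ c)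
    {j : ι} {d : Fin 3} (h : IsInner T i c a j d) :
    ∃ τ : ℝ, 0 < τ ∧ τ < 1 ∧ sideLength (T j) d = τ * sideLength (T i) c ∧
      ∀ u, 0 < u → u < τ →
        AffineMap.lineMap ((T i).points a) ((T i).points b) u ∈ openSide (T j) d := by
  obtain ⟨-, -, e, f, he, hf, hef, hpe, hfo⟩ := h
  have hfτ := eq_lineMap_of_bary_eq_zero hab hac hbc hfo.1
  have hτ := hfo.2 b hbc
  have hτ1 : bary (T i) b ((T j).points f) < 1 := by
    have hs := sum_bary (T i) ((T j).points f)
    rw [Fin.sum_three_of_ne hab hac hbc, hfo.1] at hs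
    linarith [hfo.2 a hac]
  generalize bary (T i) b ((T j).points f) = τ at *
  refine ⟨τ, hτ, hτ1, ?_, fun u h0 h1 => ?_⟩
  · rw [sideLength_eq hef he hf, sideLength_eq hab hac hbc, hpe, hfτ, dist_left_lineMap,
      Real.norm_of_nonneg hτ.le]
  · have := lineMap_mem_openSide (T := T j) hef he hf (div_pos h0 hτ) ((div_lt_one hτ).2 h1)
    rwa [hpe, hfτ, AffineMap.lineMap_lineMap_right, div_mul_cancel₀ _ hτ.ne'] at this

theorem IsInner.end_unique {i : ι} {c a a' : Fin 3} {j : ι} {d : Fin 3}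
    (h : IsInner T i c a j d) (h' : IsInner T i c a' j d) : a = a' := by
  obtain ⟨-, -, e, f, he, hf, hef, hpe, hfo⟩ := h
  obtain ⟨-, -, e', f', he', hf', hef', hpe', hfo'⟩ := h'
  by_contra hne
  have hee : e ≠ e' := by
    rintro rfl
    exact hne ((T i).independent.injective (hpe.symm.trans hpe'))
  obtain rfl : e' = f := (Fin.eq_or_eq_of_ne hef he hf he').resolve_left hee.symm
  rw [hpe'] at hfo
  exact vertex_notMem_openSide _ _ _ hfo

/-- If the lengths were larger, the two inner sides would overlap; lying on the same side of the
line they would coincide, but an inner side has only one end at an end of the longer side. -/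
theorem sideLength_add_le (hT : IsPlaneTiling T) {i : ι} {a b c : Fin 3} (hab : a ≠ b)
    (hac : a ≠ c) (hbc : b ≠ c) {j j' : ι} {d d' : Fin 3} (h : IsInner T i c a j d)
    (h' : IsInner T i c b j' d') :
    sideLength (T j) d + sideLength (T j') d' ≤ sideLength (T i) c := by
  obtain ⟨τ, hτ, hτ1, hlen, hin⟩ := h.exists_lineMap hab hac hbc
  obtain ⟨τ', hτ', hτ1', hlen', hin'⟩ := h'.exists_lineMap hab.symm hbc hac
  have hpos := sideLength_pos (T i) c
  rw [hlen, hlen', ← add_mul]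
  refine mul_le_of_le_one_left hpos.le ?_
  by_contra! hgt
  -- The midpoint of the overlap, which occupies the parameters between 1 - τ' and τ.
  have h0 : 0 < (τ + (1 - τ')) / 2 := by linarith
  have hz := hin ((τ + (1 - τ')) / 2) h0 (by linarith)
  have hz' := hin' (1 - (τ + (1 - τ')) / 2) (by linarith) (by linarith)
  rw [AffineMap.lineMap_apply_one_sub] at hz'
  obtain ⟨rfl, rfl⟩ := hT.eq_of_same_side h.1 h.2.1 h'.2.1 hz hz'
  exact hab (h.end_unique h')

/-- The midpoint of the inner side is relatively interior to both longer sides, whose tiles lie on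
the same side of the common line, so `eq_of_same_side` applies. -/
theorem IsInner.unique (hT : IsPlaneTiling T) {i i' : ι} {c c' a a' : Fin 3} (hac : a ≠ c)
    (hac' : a' ≠ c') {j : ι} {d : Fin 3} (h : IsInner T i c a j d)
    (h' : IsInner T i' c' a' j d) : i = i' ∧ c = c' ∧ a = a' := by
  have key : ∀ {i : ι} {c a : Fin 3}, a ≠ c → IsInner T i c a j d →
      (∀ x, x ≠ c → bary (T j) d ((T i).points x) = 0) ∧ bary (T j) d ((T i).points c) < 0 ∧
      midpoint ℝ ((T j).points (d + 1)) ((T j).points (d + 2)) ∈ openSide (T i) c := by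
    intro i c a hac h
    have hm := eq_mul_bary h.1
    refine ⟨fun x hx => ?_, ?_, ?_⟩
    · have := hm ((T i).points x)
      rw [bary_of_ne _ hx.symm] at this
      exact (mul_eq_zero.1 this.symm).resolve_left h.2.1.ne
    · have := hm ((T i).points c)
      rw [bary_self] at this
      by_contra! hle
      have := mul_nonpos_of_nonpos_of_nonneg h.2.1.le hle
      linarith
    · obtain ⟨-, -, e, f, he, hf, hef, hpe, hfo⟩ := h
      have hmid := midpoint_mem_openSide hac hfo
      rw [← hpe] at hmid
      have h : (e = d + 1 ∧ f = d + 2) ∨ (e = d + 2 ∧ f = d + 1) := by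
        clear * - he hf hef
        revert d e f
        decide
      rcases h with ⟨rfl, rfl⟩ | ⟨rfl, rfl⟩
      · exact hmid
      · rwa [midpoint_comm]
  obtain ⟨h1, h2, h3⟩ := key hac h
  obtain ⟨-, h2', h3'⟩ := key hac' h'
  obtain ⟨rfl, rfl⟩ := hT.eq_of_same_side h1 h2 h2' h3 h3'
  exact ⟨rfl, rfl, h.end_unique h'⟩

end IsPlaneTiling

/-! ### Angles measured by sector areas -/

namespace PlaneTriangle

variable {T : PlaneTriangle}

/-- The directions leading from the vertex `a` into the interior of the triangle. -/
def openCone (T : PlaneTriangle) (a : Fin 3) : Set Plane :=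
  {u | ∀ b, b ≠ a → 0 < (bary T b).linear u}

/-- The angle at the vertex `a`, measured by the area of the corresponding sector of the unit
disc. -/
noncomputable def angleMeasure (T : PlaneTriangle) (a : Fin 3) : ℝ :=
  volume.real (openCone T a ∩ Metric.ball 0 1)

theorem angleMeasure_nonneg (T : PlaneTriangle) (a : Fin 3) : 0 ≤ angleMeasure T a :=
  measureReal_nonneg

theorem bary_add (T : PlaneTriangle) (b : Fin 3) (u x : Plane) :
    bary T b (u + x) = (bary T b).linear u + bary T b x :=
  (bary T b).map_vadd x u

theorem sum_bary_linear (T : PlaneTriangle) (u : Plane) : ∑ b, (bary T b).linear u = 0 := by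
  have h1 := sum_bary T (u + 0)
  have h2 := sum_bary T 0
  simp only [bary_add, Finset.sum_add_distrib] at h1
  linarith

theorem continuous_bary_linear (T : PlaneTriangle) (b : Fin 3) :
    Continuous (bary T b).linear :=
  LinearMap.continuous_of_finiteDimensional _

theorem isOpen_openCone (T : PlaneTriangle) (a : Fin 3) : IsOpen (openCone T a) := by
  have : openCone T a = ⋂ b : Fin 3, ⋂ _ : b ≠ a, {u | 0 < (bary T b).linear u} := by
    ext u; simp [openCone]
  rw [this]
  exact isOpen_iInter_of_finite fun b => isOpen_iInter_of_finite fun _ =>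
    isOpen_lt continuous_const (continuous_bary_linear T b)

theorem volume_bary_linear_eq_zero (T : PlaneTriangle) (b : Fin 3) :
    volume {u | (bary T b).linear u = 0} = 0 := by
  have h := Measure.addHaar_submodule (volume : Measure Plane) (LinearMap.ker (bary T b).linear) (by
    intro htop
    rw [LinearMap.ker_eq_top] at htop
    obtain ⟨a, hba⟩ : ∃ a, b ≠ a := ⟨b + 1, by clear htop; revert b; decide⟩
    have h1 := bary_add T b (T.points b - T.points a) (T.points a)
    rw [sub_add_cancel, bary_self, bary_of_ne T hba, htop] at h1
    simp at h1)
  exact h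

/-- Some index differs from both `a` and `b`, and its coordinate would have to both increase and
decrease. So the three angular sectors and their reflections are packed into one disc, which bounds
the angle sum. -/
theorem disjoint_of_neg (T : PlaneTriangle) (a b : Fin 3) :
    Disjoint (openCone T a) (-openCone T b) := by
  rw [Set.disjoint_left]
  intro u hu hu'
  rw [Set.mem_neg] at hu'
  have hu'' : ∀ x, x ≠ b → (bary T x).linear u < 0 := by
    intro x hx
    have := hu' x hx
    rw [map_neg] at this
    linarith
  obtain ⟨x, hxa, hxb⟩ : ∃ x : Fin 3, x ≠ a ∧ x ≠ b := by
    clear hu hu' hu''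
    revert a b
    decide
  exact absurd (hu x hxa) (hu'' x hxb).not_gt

theorem disjoint_openCone (T : PlaneTriangle) {a b : Fin 3} (hab : a ≠ b) :
    Disjoint (openCone T a) (openCone T b) := by
  rw [Set.disjoint_left]
  intro u hu hu'
  have hs := sum_bary_linear T u
  obtain ⟨c, hca, hcb⟩ := Fin.exists_third hab
  rw [Fin.sum_three_of_ne hab hca.symm hcb.symm] at hs
  have := hu b hab.symm
  have := hu' a hab
  have := hu c hca
  linarith

theorem volume_real_neg (s : Set Plane) : volume.real (-s) = volume.real s := by
  rw [Measure.real, Measure.real, Measure.measure_neg]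

/-- The angle sum of a triangle is at most a straight angle. -/
theorem two_mul_sum_angleMeasure_le (T : PlaneTriangle) :
    2 * ∑ a, angleMeasure T a ≤ volume.real (Metric.ball (0 : Plane) 1) := by
  have hfin : volume (Metric.ball (0 : Plane) 1) ≠ ⊤ := measure_ball_lt_top.ne
  set U := ⋃ a ∈ (Finset.univ : Finset (Fin 3)), openCone T a ∩ Metric.ball 0 1 with hU
  have hmeas : ∀ a, MeasurableSet (openCone T a ∩ Metric.ball 0 1) := fun a =>
    (isOpen_openCone T a).measurableSet.inter measurableSet_ball
  have hUb : U ⊆ Metric.ball 0 1 := Set.iUnion₂_subset fun a _ => Set.inter_subset_right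
  have h1 : volume.real U = ∑ a, angleMeasure T a := by
    refine measureReal_biUnion_finset ?_ (fun a _ => hmeas a)
      (fun a _ => measure_ne_top_of_subset Set.inter_subset_right hfin)
    intro a _ b _ hab
    exact (disjoint_openCone T hab).mono Set.inter_subset_left Set.inter_subset_left
  have hUmeas : MeasurableSet U := Finset.measurableSet_biUnion _ fun a _ => hmeas a
  have hnb : -U ⊆ Metric.ball 0 1 := by
    intro u hu
    have := hUb (Set.mem_neg.1 hu)
    simpa using this
  have hdisj : Disjoint U (-U) := by
    rw [Set.disjoint_left]
    intro u hu hu'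
    rw [Set.mem_neg] at hu'
    simp only [hU, Set.mem_iUnion] at hu hu'
    obtain ⟨a, _, ha, _⟩ := hu
    obtain ⟨b, _, hb, _⟩ := hu'
    exact Set.disjoint_left.1 (disjoint_of_neg T a b) ha hb
  have h2 : volume.real (U ∪ -U) = volume.real U + volume.real (-U) :=
    measureReal_union hdisj hUmeas.neg (measure_ne_top_of_subset hUb hfin)
      (measure_ne_top_of_subset hnb hfin)
  have h3 : volume.real (U ∪ -U) ≤ volume.real (Metric.ball (0 : Plane) 1) :=
    measureReal_mono (Set.union_subset hUb hnb) hfin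
  rw [volume_real_neg, h1] at h2
  linarith

/-- Up to a null set, the closed cone at a vertex is the open one. -/
theorem volume_real_closedCone_le (T : PlaneTriangle) (a : Fin 3) :
    volume.real ({u | ∀ b, b ≠ a → 0 ≤ (bary T b).linear u} ∩ Metric.ball 0 1) ≤
      angleMeasure T a := by
  have hsub : {u | ∀ b, b ≠ a → 0 ≤ (bary T b).linear u} ∩ Metric.ball 0 1 ⊆
      (openCone T a ∩ Metric.ball 0 1) ∪ ⋃ b, {u | (bary T b).linear u = 0} := by
    rintro u ⟨hu, hu1⟩
    by_cases h : ∃ b, (bary T b).linear u = 0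
    · exact Or.inr (by simpa using h)
    · push Not at h
      exact Or.inl ⟨fun b hb => lt_of_le_of_ne (hu b hb) (h b).symm, hu1⟩
  have h0 : volume (⋃ b, {u | (bary T b).linear u = 0}) = 0 :=
    measure_iUnion_null fun b => volume_bary_linear_eq_zero T b
  refine ENNReal.toReal_mono (measure_ne_top_of_subset Set.inter_subset_right
    measure_ball_lt_top.ne) ((measure_mono hsub).trans ((measure_union_le _ _).trans ?_))
  rw [h0, add_zero]

/-- The half disc and its reflection cover the disc up to a null line. -/
theorem volume_real_ball_le_halfPlane (T : PlaneTriangle) (d : Fin 3) :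
    volume.real (Metric.ball (0 : Plane) 1) ≤
      2 * volume.real ({u | (bary T d).linear u < 0} ∩ Metric.ball 0 1) := by
  set H := {u | (bary T d).linear u < 0} ∩ Metric.ball 0 1 with hH
  have hfin : volume (Metric.ball (0 : Plane) 1) ≠ ⊤ := measure_ball_lt_top.ne
  have hHfin : volume H ≠ ⊤ := measure_ne_top_of_subset Set.inter_subset_right hfin
  have hsub : Metric.ball (0 : Plane) 1 ⊆ (H ∪ -H) ∪ {u | (bary T d).linear u = 0} := by
    intro u hu
    rcases lt_trichotomy ((bary T d).linear u) 0 with h | h | h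
    · exact Or.inl (Or.inl ⟨h, hu⟩)
    · exact Or.inr h
    · refine Or.inl (Or.inr (Set.mem_neg.2 ⟨?_, by simpa using hu⟩))
      simpa using h
  have h1 : volume (Metric.ball (0 : Plane) 1) ≤ volume H + volume H := by
    refine (measure_mono hsub).trans ((measure_union_le _ _).trans ?_)
    rw [volume_bary_linear_eq_zero, add_zero]
    refine (measure_union_le _ _).trans ?_
    rw [Measure.measure_neg]
  have h2 := ENNReal.toReal_mono (ENNReal.add_ne_top.2 ⟨hHfin, hHfin⟩) h1
  rw [ENNReal.toReal_add hHfin hHfin] at h2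
  simp only [Measure.real]
  linarith

end PlaneTriangle

/-! ### Vertices in the relative interior of a side -/

namespace IsPlaneTiling

open PlaneTriangle

variable {ι : Type*} {T : ι → PlaneTriangle}

theorem vertex_tile_ne {i j : ι} {a d : Fin 3}
    (h : (T i).points a ∈ openSide (T j) d) : i ≠ j := by
  rintro rfl
  exact vertex_notMem_openSide _ _ _ h

/-- A vertex of a tile lies in the relative interior of at most one side. -/
theorem openSide_unique (hT : IsPlaneTiling T) {i j j' : ι} {a d d' : Fin 3}
    (h : (T i).points a ∈ openSide (T j) d) (h' : (T i).points a ∈ openSide (T j') d') :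
    j = j' ∧ d = d' := by
  by_cases hjj : j = j'
  · subst hjj
    exact ⟨rfl, openSide_index_unique h h'⟩
  -- Two such sides would lie on one line with `j` and `j'` on opposite sides of it. Tile `i` would
  -- be beyond both, hence contained in the line.
  exfalso
  set v := (T i).points a with hv
  have hvj := openSide_subset_region h
  have hneg : ∀ e, bary (T j') d' ((T j).points e) ≤ 0 := fun e =>
    hT.bary_nonpos hjj h' hvj (vertex_mem_region _ _)
  have hline : ∀ e, e ≠ d → bary (T j') d' ((T j).points e) = 0 := by
    intro e he
    have hsum := affine_apply_eq_sum (T j) (bary (T j') d') v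
    rw [h'.1] at hsum
    have := (Finset.sum_eq_zero_iff_of_nonpos fun e _ => mul_nonpos_of_nonneg_of_nonpos
      (mem_region.1 hvj e) (hneg e)).1 hsum.symm e (Finset.mem_univ e)
    exact (mul_eq_zero.1 this).resolve_left (h.2 e he).ne'
  obtain ⟨x, hx⟩ := exists_bary_vertex_ne_zero (T i) (T j') d'
  have h1 : bary (T j') d' ((T i).points x) ≤ 0 :=
    hT.bary_nonpos (vertex_tile_ne h') h' (vertex_mem_region _ _) (vertex_mem_region _ _)
  have h2 : bary (T j) d ((T i).points x) ≤ 0 :=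
    hT.bary_nonpos (vertex_tile_ne h) h (vertex_mem_region _ _) (vertex_mem_region _ _)
  have h3 := eq_mul_bary hline ((T i).points x)
  have h4 := mul_nonneg_of_nonpos_of_nonpos (hneg d) h2
  exact hx (le_antisymm h1 (h3 ▸ h4))

/-- If a vertex of the tiling lies in the relative interior of a side of the tile `j`, it is a
vertex of every other tile containing it. -/
theorem exists_vertex_eq (hT : IsPlaneTiling T) {i j k : ι} {a d : Fin 3}
    (h : (T i).points a ∈ openSide (T j) d) (hkj : k ≠ j) (hk : (T i).points a ∈ region (T k)) :
    ∃ e, (T k).points e = (T i).points a := by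
  have hk0 := mem_region.1 hk
  -- The point is not interior to tile `k`, which would then overlap `j`, nor relatively interior to
  -- a side of `k`, by `openSide_unique`. Two coordinates therefore vanish.
  obtain ⟨x, hx⟩ : ∃ x, bary (T k) x ((T i).points a) = 0 := by
    by_contra! hne
    refine hkj (hT.eq_of_common_direction (openSide_subset_region h) hk
      (openSide_subset_region h) fun e he => absurd he (hne e)).symm
  obtain ⟨y, hyx, hy⟩ : ∃ y, y ≠ x ∧ bary (T k) y ((T i).points a) = 0 := by
    by_contra! hne
    exact hkj (hT.openSide_unique h
      ⟨hx, fun e he => lt_of_le_of_ne (hk0 e) (hne e he).symm⟩).1.symm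
  obtain ⟨z, hzy, hzx⟩ := Fin.exists_third hyx
  exact ⟨z, (eq_vertex_of_bary hzy hzx hyx hy hx).symm⟩

/-- The angles at a vertex lying in the relative interior of a side add up to a straight angle. -/
theorem volume_real_ball_le_sum_angleMeasure (hT : IsPlaneTiling T)
    (hF : ∀ R, (near T R).Finite) {i j : ι} {a d : Fin 3}
    (h : (T i).points a ∈ openSide (T j) d) (S : Finset (ι × Fin 3))
    (hS : ∀ k e, (T k).points e = (T i).points a → (k, e) ∈ S) :
    volume.real (Metric.ball (0 : Plane) 1) ≤ 2 * ∑ s ∈ S, angleMeasure (T s.1) s.2 := by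
  refine (volume_real_ball_le_halfPlane (T j) d).trans ?_
  gcongr
  have hsub : {u | (bary (T j) d).linear u < 0} ∩ Metric.ball 0 1 ⊆
      ⋃ s ∈ S, {u | ∀ b, b ≠ s.2 → 0 ≤ (bary (T s.1) b).linear u} ∩ Metric.ball 0 1 := by
    rintro u ⟨hu, hu1⟩
    set v := (T i).points a with hv
    have hpt : ∀ (k : ι) (b : Fin 3) (t : ℝ), bary (T k) b (AffineMap.lineMap v (u + v) t) =
        bary (T k) b v + t * (bary (T k) b).linear u := by
      intro k b t
      rw [AffineMap.apply_lineMap_real, bary_add]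
      ring
    -- The ray from `v` in direction `u` leaves `j`, so another tile contains points of it
    -- arbitrarily close to `v`; that tile has `v` as a vertex and `u` in its closed cone.
    obtain ⟨k, hkj, hvk, hfreq⟩ := exists_frequently_mem hF (tendsto_lineMap_zero v (u + v))
      (Q := fun k => k ≠ j) (by
        filter_upwards [self_mem_nhdsWithin] with t ht
        obtain ⟨k, hk⟩ := hT.exists_mem_region (AffineMap.lineMap v (u + v) t)
        refine ⟨k, ?_, hk⟩
        rintro rfl
        have h1 := mem_region.1 hk d
        rw [hpt, h.1] at h1
        have : t * (bary (T k) d).linear u < 0 := mul_neg_of_pos_of_neg ht hu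
        linarith)
    obtain ⟨e, he⟩ := hT.exists_vertex_eq h hkj hvk
    obtain ⟨t, htk, ht⟩ := (hfreq.and_eventually self_mem_nhdsWithin).exists
    refine Set.mem_biUnion (hS k e he) ⟨fun b hb => ?_, hu1⟩
    have h1 := mem_region.1 htk b
    rw [hpt, hv, ← he, bary_of_ne _ hb, zero_add] at h1
    exact nonneg_of_mul_nonneg_right h1 ht
  refine (measureReal_mono hsub ?_).trans ((measureReal_biUnion_finset_le _ _).trans
    (Finset.sum_le_sum fun s _ => volume_real_closedCone_le _ _))
  refine measure_ne_top_of_subset ?_ (measure_ball_lt_top (x := (0 : Plane)) (r := 1)).ne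
  exact Set.iUnion₂_subset fun s _ => Set.inter_subset_right

/-- At most two sides are continued beyond a given vertex. -/
theorem card_isContinuing_le_two (hT : IsPlaneTiling T) (v : Plane)
    (S : Finset (ι × Fin 3 × Fin 3))
    (hS : ∀ s ∈ S, IsContinuing T s.1 s.2.1 s.2.2 ∧ (T s.1).points s.2.2 = v) : S.card ≤ 2 := by
  rcases S.eq_empty_or_nonempty with rfl | ⟨⟨i₀, c₀, a₀⟩, hs₀⟩
  · simp
  obtain ⟨⟨-, j, d, hvo, -⟩, hv₀⟩ := hS _ hs₀
  simp only at hvo hv₀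
  obtain ⟨e, hed⟩ : ∃ e, e ≠ d := ⟨d + 1, by clear hvo; revert d; decide⟩
  obtain ⟨e', he'e, he'd⟩ := Fin.exists_third hed
  have hline : ∀ s ∈ S, (∀ x, x ≠ s.2.1 → bary (T j) d ((T s.1).points x) = 0) ∧
      bary (T j) d ((T s.1).points s.2.1) < 0 := by
    rintro ⟨i, c, a⟩ hs
    obtain ⟨⟨-, j', d', hvo', hl⟩, hv⟩ := hS _ hs
    simp only at hvo' hl hv ⊢
    rw [hv, ← hv₀] at hvo'
    obtain ⟨rfl, rfl⟩ := hT.openSide_unique hvo hvo'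
    refine ⟨hl, ?_⟩
    rw [hv₀, ← hv] at hvo
    refine lt_of_le_of_ne (hT.bary_nonpos (vertex_tile_ne hvo) hvo
      (vertex_mem_region _ _) (vertex_mem_region _ _)) fun h0 => ?_
    obtain ⟨x, hx⟩ := exists_bary_vertex_ne_zero (T i) (T j) d
    by_cases hxc : x = c
    · exact hx (hxc ▸ h0)
    · exact hx (hl x hxc)
  rw [hv₀] at hvo
  have hext : ∀ x y, bary (T j) d x = 0 → bary (T j) d y = 0 →
      bary (T j) e x = bary (T j) e y → x = y := by
    intro x y hx hy hxy
    rw [eq_lineMap_of_bary_eq_zero he'e he'd hed hx, eq_lineMap_of_bary_eq_zero he'e he'd hed hy,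
      hxy]
  classical
  -- The Boolean records in which direction along the line the side leaves `v`. All these tiles lie
  -- on the same side of the line, so sides leaving in the same direction overlap and coincide.
  have hinj : Set.InjOn (fun s : ι × Fin 3 × Fin 3 => decide (∃ x, x ≠ s.2.1 ∧
      bary (T j) e v < bary (T j) e ((T s.1).points x))) S := by
    rintro ⟨i, c, a⟩ hs ⟨i', c', a'⟩ hs' heq
    have key : ∀ s ∈ S, ∃ b, b ≠ s.2.1 ∧ s.2.2 ≠ s.2.1 ∧ s.2.2 ≠ b ∧
        bary (T j) e ((T s.1).points b) ≠ bary (T j) e v ∧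
        ((∃ x, x ≠ s.2.1 ∧ bary (T j) e v < bary (T j) e ((T s.1).points x)) ↔
          bary (T j) e v < bary (T j) e ((T s.1).points b)) := by
      rintro ⟨i, c, a⟩ hs
      obtain ⟨⟨hac, -⟩, hv⟩ := hS _ hs
      have hl := (hline _ hs).1
      simp only at hac hv hl ⊢
      obtain ⟨b, hba, hbc⟩ := Fin.exists_third hac
      refine ⟨b, hbc, hac, hba.symm, fun h => ?_, ⟨?_, fun h => ⟨b, hbc, h⟩⟩⟩
      · have := hext _ _ (hl b hbc) hvo.1 h
        rw [← hv] at this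
        exact hba ((T i).independent.injective this)
      · rintro ⟨x, hx, hlt⟩
        rcases Fin.eq_or_eq_of_ne hba.symm hac hbc hx with rfl | rfl
        · rw [hv] at hlt
          exact absurd hlt (lt_irrefl _)
        · exact hlt
    obtain ⟨b, hbc, hac, hab, hne, hiff⟩ := key _ hs
    obtain ⟨b', hbc', hac', hab', hne', hiff'⟩ := key _ hs'
    have hl := hline _ hs
    have hl' := hline _ hs'
    have hv := (hS _ hs).2
    have hv' := (hS _ hs').2
    simp only at hbc hac hab hne hiff hbc' hac' hab' hne' hiff' hl hl' heq hv hv'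
    rw [decide_eq_decide, hiff, hiff'] at heq
    -- σ and σ' are signed lengths of equal sign; the point at offset σσ'/(σ + σ') from `v` is
    -- relatively interior to both sides.
    obtain ⟨σ, hσ⟩ : ∃ σ, σ = bary (T j) e ((T i).points b) - bary (T j) e v := ⟨_, rfl⟩
    obtain ⟨σ', hσ'⟩ : ∃ σ', σ' = bary (T j) e ((T i').points b') - bary (T j) e v := ⟨_, rfl⟩
    have hfrac : 0 < σ / (σ + σ') ∧ σ / (σ + σ') < 1 ∧ 0 < σ' / (σ + σ') ∧ σ' / (σ + σ') < 1 ∧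
        σ + σ' ≠ 0 := by
      rcases lt_or_gt_of_ne hne with h | h
      · have h' := lt_of_le_of_ne (not_lt.1 (fun h' => absurd (heq.2 h') h.not_gt)) hne'
        have h1 : σ < 0 := by linarith
        have h2 : σ' < 0 := by linarith
        have h3 : σ + σ' < 0 := by linarith
        exact ⟨div_pos_of_neg_of_neg h1 h3, (div_lt_one_of_neg h3).2 (by linarith),
          div_pos_of_neg_of_neg h2 h3, (div_lt_one_of_neg h3).2 (by linarith), h3.ne⟩
      · have h' := heq.1 h
        have h1 : 0 < σ := by linarith
        have h2 : 0 < σ' := by linarith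
        have h3 : 0 < σ + σ' := by linarith
        exact ⟨div_pos h1 h3, (div_lt_one h3).2 (by linarith),
          div_pos h2 h3, (div_lt_one h3).2 (by linarith), h3.ne'⟩
    obtain ⟨f1, f2, f3, f4, f5⟩ := hfrac
    have hz := lineMap_mem_openSide (T := T i) hab hac hbc f3 f4
    have hz' := lineMap_mem_openSide (T := T i') hab' hac' hbc' f1 f2
    have hzz : AffineMap.lineMap ((T i).points a) ((T i).points b) (σ' / (σ + σ')) =
        AffineMap.lineMap ((T i').points a') ((T i').points b') (σ / (σ + σ')) := by
      apply hext
      · rw [AffineMap.apply_lineMap_real, hl.1 a hac, hl.1 b hbc]; ring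
      · rw [AffineMap.apply_lineMap_real, hl'.1 a' hac', hl'.1 b' hbc']; ring
      · rw [AffineMap.apply_lineMap_real, AffineMap.apply_lineMap_real, hv, hv',
          show bary (T j) e ((T i).points b) = σ + bary (T j) e v by linarith,
          show bary (T j) e ((T i').points b') = σ' + bary (T j) e v by linarith]
        ring
    rw [← hzz] at hz'
    obtain ⟨rfl, rfl⟩ := hT.eq_of_same_side hl.1 hl.2 hl'.2 hz hz'
    rw [(T i).independent.injective (hv.trans hv'.symm)]
  have := Finset.card_le_card_of_injOn (t := (Finset.univ : Finset Bool)) _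
    (fun _ _ => Finset.mem_univ _) hinj
  simpa using this

end IsPlaneTiling

/-! ### Counting tiles, continued ends and maximal sides -/

namespace PlaneTriangle

theorem area_eq_interior (T : PlaneTriangle) : area T = volume.real (interior (region T)) := by
  rw [area, Measure.real, Measure.real]
  congr 1
  refine le_antisymm ?_ (measure_mono interior_subset)
  have hsub : region T ⊆ interior (region T) ∪ frontier (region T) := by
    rw [← closure_eq_interior_union_frontier]
    exact subset_closure
  refine (measure_mono hsub).trans ((measure_union_le _ _).trans ?_)
  rw [(convex_region T).addHaar_frontier volume, add_zero]

end PlaneTriangle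

namespace IsPlaneTiling

open PlaneTriangle

variable {ι : Type*} {T : ι → PlaneTriangle}

theorem region_subset_ball {i : ι} {R : ℝ} (hper : perimeter (T i) = 1) (hi : i ∈ near T R) :
    region (T i) ⊆ Metric.ball 0 (R + 1) := by
  obtain ⟨x, hx, hxR⟩ := hi
  intro y hy
  have h1 := dist_le_half hper hy hx
  have h2 := dist_triangle y x 0
  rw [Metric.mem_closedBall] at hxR
  rw [Metric.mem_ball]
  linarith

theorem mem_near_succ {i j : ι} {R : ℝ} (hper : perimeter (T i) = 1) (hi : i ∈ near T R)
    {x : Plane} (hx : x ∈ region (T i)) (hxj : x ∈ region (T j)) : j ∈ near T (R + 1) :=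
  ⟨x, hxj, Metric.ball_subset_closedBall (region_subset_ball hper hi hx)⟩

/-- Packing: tiles have diameter at most 1/2, so their disjoint interiors all lie in the enlarged
ball. -/
theorem card_mul_le (hT : IsPlaneTiling T) (hper : ∀ i, perimeter (T i) = 1) {ε : ℝ}
    (harea : ∀ i, ε ≤ area (T i)) {R : ℝ} (S : Finset ι) (hS : ∀ i ∈ S, i ∈ near T R) :
    S.card * ε ≤ volume.real (Metric.ball (0 : Plane) (R + 1)) := by
  have hfin : volume (Metric.ball (0 : Plane) (R + 1)) ≠ ⊤ := measure_ball_lt_top.ne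
  have hsub : ∀ i ∈ S, interior (region (T i)) ⊆ Metric.ball 0 (R + 1) := fun i hi =>
    interior_subset.trans (region_subset_ball (hper i) (hS i hi))
  have h1 : volume.real (⋃ i ∈ S, interior (region (T i))) = ∑ i ∈ S, area (T i) := by
    rw [measureReal_biUnion_finset (fun i _ j _ hij => hT.disjoint_interiors i j hij)
      (fun i _ => isOpen_interior.measurableSet)
      (fun i hi => measure_ne_top_of_subset (hsub i hi) hfin)]
    exact Finset.sum_congr rfl fun i _ => (area_eq_interior _).symm
  have h2 := measureReal_mono (Set.iUnion₂_subset hsub) hfin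
  rw [h1] at h2
  refine le_trans ?_ h2
  rw [← nsmul_eq_mul]
  exact Finset.card_nsmul_le_sum _ _ _ fun i _ => harea i

theorem finite_near (hT : IsPlaneTiling T) (hper : ∀ i, perimeter (T i) = 1) {ε : ℝ}
    (hε : 0 < ε) (harea : ∀ i, ε ≤ area (T i)) (R : ℝ) : (near T R).Finite := by
  by_contra hinf
  obtain ⟨n, hn⟩ := exists_nat_gt (volume.real (Metric.ball (0 : Plane) (R + 1)) / ε)
  obtain ⟨S, hS, hcard⟩ := Set.Infinite.exists_subset_card_eq hinf n
  have := hT.card_mul_le hper harea S fun i hi => hS hi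
  rw [hcard] at this
  rw [div_lt_iff₀ hε] at hn
  linarith

open Classical in
/-- The continued side ends of the tiles near the ball of radius `R`. -/
noncomputable def continuingEnds (hF : ∀ R, (near T R).Finite) (R : ℝ) :
    Finset (ι × Fin 3 × Fin 3) :=
  ((hF R).toFinset ×ˢ Finset.univ).filter fun s => IsContinuing T s.1 s.2.1 s.2.2

open Classical in
/-- The sides, not continued at either end, of the tiles near the ball of radius `R`. -/
noncomputable def maximalSides (hF : ∀ R, (near T R).Finite) (R : ℝ) : Finset (ι × Fin 3) :=
  ((hF R).toFinset ×ˢ Finset.univ).filter fun s => ∀ a, ¬ IsContinuing T s.1 s.2 a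

/-- Double counting of angles: each vertex in question uses up a straight angle, and each tile
supplies at most one. -/
theorem card_continuingEnds_le (hT : IsPlaneTiling T) (hF : ∀ R, (near T R).Finite)
    (hper : ∀ i, perimeter (T i) = 1) (R : ℝ) :
    (continuingEnds hF R).card ≤ 2 * (hF (R + 1)).toFinset.card := by
  classical
  let V := (continuingEnds hF R).image fun s => (T s.1).points s.2.2
  have h1 : (continuingEnds hF R).card ≤ 2 * V.card := by
    refine Finset.card_le_mul_card_image _ _ fun v _ => ?_
    refine hT.card_isContinuing_le_two v _ fun s hs => ?_
    rw [Finset.mem_filter, continuingEnds, Finset.mem_filter] at hs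
    exact ⟨hs.1.2, hs.2⟩
  refine h1.trans (Nat.mul_le_mul_left 2 ?_)
  set β := volume.real (Metric.ball (0 : Plane) 1) with hβ
  have hβpos : 0 < β := ENNReal.toReal_pos (Metric.measure_ball_pos _ _ one_pos).ne'
    measure_ball_lt_top.ne
  set P : Finset (ι × Fin 3) := (hF (R + 1)).toFinset ×ˢ Finset.univ with hP
  have h2 : ∀ v ∈ V, β ≤ 2 * ∑ s ∈ P with (T s.1).points s.2 = v, angleMeasure (T s.1) s.2 := by
    intro v hv
    obtain ⟨⟨i, c, a⟩, hs, rfl⟩ := Finset.mem_image.1 hv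
    rw [continuingEnds, Finset.mem_filter, Finset.mem_product, Set.Finite.mem_toFinset] at hs
    obtain ⟨⟨hi, -⟩, -, j, d, hjd, -⟩ := hs
    refine hT.volume_real_ball_le_sum_angleMeasure hF hjd _ fun k e hke => ?_
    refine Finset.mem_filter.2 ⟨Finset.mem_product.2 ⟨?_, Finset.mem_univ _⟩, hke⟩
    rw [Set.Finite.mem_toFinset]
    exact mem_near_succ (hper i) hi (vertex_mem_region (T i) a) (hke ▸ vertex_mem_region (T k) e)
  have h3 : ∑ v ∈ V, ∑ s ∈ P with (T s.1).points s.2 = v, angleMeasure (T s.1) s.2 ≤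
      ∑ s ∈ P, angleMeasure (T s.1) s.2 :=
    Finset.sum_fiberwise_le_sum_of_sum_fiber_nonneg fun v _ =>
      Finset.sum_nonneg fun s _ => angleMeasure_nonneg _ _
  have h4 : 2 * ∑ s ∈ P, angleMeasure (T s.1) s.2 ≤ (hF (R + 1)).toFinset.card * β := by
    rw [hP, Finset.sum_product, Finset.mul_sum, ← nsmul_eq_mul]
    exact Finset.sum_le_card_nsmul _ _ _ fun i _ => two_mul_sum_angleMeasure_le (T i)
  have h5 : V.card * β ≤ 2 * ∑ s ∈ P, angleMeasure (T s.1) s.2 := by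
    rw [← nsmul_eq_mul]
    refine (Finset.card_nsmul_le_sum _ _ _ h2).trans ?_
    rw [← Finset.mul_sum]
    gcongr
  exact_mod_cast le_of_mul_le_mul_right (h5.trans h4) hβpos

theorem three_mul_card_le (hF : ∀ R, (near T R).Finite) (R : ℝ) :
    3 * (hF R).toFinset.card ≤ (maximalSides hF R).card + (continuingEnds hF R).card := by
  classical
  have hsub : (hF R).toFinset ×ˢ (Finset.univ : Finset (Fin 3)) ⊆
      maximalSides hF R ∪ (continuingEnds hF R).image fun s => (s.1, s.2.1) := by
    rintro ⟨i, c⟩ hs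
    rw [Finset.mem_union]
    by_cases h : ∀ a, ¬ IsContinuing T i c a
    · exact Or.inl (Finset.mem_filter.2 ⟨hs, h⟩)
    · push Not at h
      obtain ⟨a, ha⟩ := h
      refine Or.inr (Finset.mem_image.2 ⟨(i, c, a), Finset.mem_filter.2 ⟨?_, ha⟩, rfl⟩)
      exact Finset.mem_product.2 ⟨(Finset.mem_product.1 hs).1, Finset.mem_univ _⟩
  have := (Finset.card_le_card hsub).trans (Finset.card_union_le _ _)
  rw [Finset.card_product, Finset.card_univ, Fintype.card_fin, mul_comm] at this
  exact this.trans (Nat.add_le_add_left Finset.card_image_le _)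

/-- Each maximal side and its two inner sides have total deficit at least `w`, where a side of
length l has deficit `w` - l. These triples are disjoint, and unit perimeter fixes the total deficit
of a tile at 3w - 1. -/
theorem mul_card_maximalSides_le (hT : IsPlaneTiling T) (hF : ∀ R, (near T R).Finite)
    (hper : ∀ i, perimeter (T i) = 1)
   (hshare : ∀ i j, i ≠ j → ¬ ShareSide (T i) (T j)) {w : ℝ}
    (hw : ∀ i c, sideLength (T i) c ≤ w) (R : ℝ) :
    w * (maximalSides hF R).card ≤ (3 * w - 1) * (hF (R + 1)).toFinset.card := by
  classical
  set A := maximalSides hF R with hA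
  have hmem : ∀ s ∈ A, s.1 ∈ near T R ∧ ∀ a, ¬ IsContinuing T s.1 s.2 a := by
    intro s hs
    rw [hA, maximalSides, Finset.mem_filter, Finset.mem_product, Set.Finite.mem_toFinset] at hs
    exact ⟨hs.1.1, hs.2⟩
  -- The slot of the opposite vertex holds the maximal side itself, the slots of its two ends hold
  -- the inner sides. Outside `A` the value is arbitrary.
  have hex : ∀ x : (ι × Fin 3) × Fin 3, ∃ p : ι × Fin 3, x.1 ∈ A →
      (x.2 = x.1.2 → p = x.1) ∧ (x.2 ≠ x.1.2 → IsInner T x.1.1 x.1.2 x.2 p.1 p.2) := by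
    rintro ⟨s, a⟩
    by_cases hs : s ∈ A
    · by_cases ha : a = s.2
      · exact ⟨s, fun _ => ⟨fun _ => rfl, fun h => absurd ha h⟩⟩
      · obtain ⟨j, d, h⟩ := hT.exists_isInner hF hshare ha (hmem s hs).2
        exact ⟨(j, d), fun _ => ⟨fun h => absurd h ha, fun _ => h⟩⟩
    · exact ⟨s, fun h => absurd h hs⟩
  choose Φ hΦ using hex
  have hinj : Set.InjOn Φ (A ×ˢ (Finset.univ : Finset (Fin 3)) : Finset _) := by
    rintro ⟨s, a⟩ hs ⟨s', a'⟩ hs' heq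
    have hsA := (Finset.mem_product.1 hs).1
    have hsA' := (Finset.mem_product.1 hs').1
    obtain ⟨h1, h2⟩ := hΦ (s, a) hsA
    obtain ⟨h1', h2'⟩ := hΦ (s', a') hsA'
    simp only at h1 h2 h1' h2' hsA hsA'
    by_cases ha : a = s.2 <;> by_cases ha' : a' = s'.2
    · have : s = s' := (h1 ha).symm.trans (heq.trans (h1' ha'))
      subst this
      rw [ha, ha']
    · obtain ⟨f, hf⟩ := (h2' ha').isContinuing
      rw [← heq, h1 ha] at hf
      exact absurd hf ((hmem s hsA).2 f)
    · obtain ⟨f, hf⟩ := (h2 ha).isContinuing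
      rw [heq, h1' ha'] at hf
      exact absurd hf ((hmem s' hsA').2 f)
    · have h3 := h2 ha
      rw [heq] at h3
      obtain ⟨e1, e2, e3⟩ := h3.unique hT ha ha' (h2' ha')
      rw [e3, Prod.ext e1 e2]
  set P : Finset (ι × Fin 3) := (hF (R + 1)).toFinset ×ˢ Finset.univ with hP
  have himg : (A ×ˢ (Finset.univ : Finset (Fin 3))).image Φ ⊆ P := by
    intro p hp
    obtain ⟨⟨s, a⟩, hs, rfl⟩ := Finset.mem_image.1 hp
    have hsA := (Finset.mem_product.1 hs).1
    refine Finset.mem_product.2 ⟨?_, Finset.mem_univ _⟩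
    rw [Set.Finite.mem_toFinset]
    obtain ⟨h1, h2⟩ := hΦ (s, a) hsA
    simp only at h1 h2 hsA
    by_cases ha : a = s.2
    · rw [h1 ha]
      exact mem_near_succ (hper _) (hmem s hsA).1 (vertex_mem_region _ 0) (vertex_mem_region _ 0)
    · obtain ⟨-, -, e, f, -, -, -, hpe, -⟩ := h2 ha
      exact mem_near_succ (hper _) (hmem s hsA).1 (vertex_mem_region _ a)
        (hpe ▸ vertex_mem_region _ e)
  have hsum : ∑ x ∈ A ×ˢ (Finset.univ : Finset (Fin 3)),
      (w - sideLength (T (Φ x).1) (Φ x).2) ≤ ∑ p ∈ P, (w - sideLength (T p.1) p.2) := by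
    rw [← Finset.sum_image (f := fun p : ι × Fin 3 => w - sideLength (T p.1) p.2) hinj]
    exact Finset.sum_le_sum_of_subset_of_nonneg himg fun p _ _ => sub_nonneg.2 (hw _ _)
  have hright : ∑ p ∈ P, (w - sideLength (T p.1) p.2) =
      (3 * w - 1) * (hF (R + 1)).toFinset.card := by
    rw [hP, Finset.sum_product, mul_comm, ← nsmul_eq_mul, ← Finset.sum_const]
    refine Finset.sum_congr rfl fun i _ => ?_
    rw [Finset.sum_sub_distrib]
    simp only [sum_sideLength, hper]
    simp
  have hleft : A.card * w ≤ ∑ x ∈ A ×ˢ (Finset.univ : Finset (Fin 3)),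
      (w - sideLength (T (Φ x).1) (Φ x).2) := by
    rw [Finset.sum_product, ← nsmul_eq_mul]
    refine Finset.card_nsmul_le_sum _ _ _ fun s hs => ?_
    obtain ⟨a, ha⟩ : ∃ a, a ≠ s.2 := ⟨s.2 + 1, by generalize s.2 = c; revert c; decide⟩
    obtain ⟨b, hba, hb⟩ := Fin.exists_third ha
    rw [Fin.sum_three_of_ne hba.symm ha hb, (hΦ (s, s.2) hs).1 rfl]
    have h1 := hT.sideLength_add_le hba.symm ha hb ((hΦ (s, a) hs).2 ha) ((hΦ (s, b) hs).2 hb)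
    have h2 := hw s.1 s.2
    linarith
  rw [hright] at hsum
  linarith

end IsPlaneTiling

/-! ### Exponential against quadratic growth -/

open PlaneTriangle IsPlaneTiling

theorem theorem4 {ι : Type*} (T : ι → PlaneTriangle) (hT : IsPlaneTiling T)
    (hperim : ∀ i, PlaneTriangle.perimeter (T i) = 1)
    (ε : ℝ) (hε : 0 < ε) (harea : ∀ i, ε ≤ PlaneTriangle.area (T i)) :
    ∃ i j, i ≠ j ∧ PlaneTriangle.ShareSide (T i) (T j) := by
  by_contra! hshare
  have hF := hT.finite_near hperim hε harea
  obtain ⟨w, hw, hw2⟩ : ∃ w : ℝ, (∀ i c, sideLength (T i) c ≤ w) ∧ w < 1 / 2 := by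
    refine ⟨_, fun i c => sideLength_le_of_area hε (hperim i) (harea i) c, ?_⟩
    have : 0 < volume.real (Metric.closedBall (0 : Plane) 2) :=
      ENNReal.toReal_pos (Metric.measure_closedBall_pos _ _ two_pos).ne'
        measure_closedBall_lt_top.ne
    have : 0 < (ε / volume.real (Metric.closedBall (0 : Plane) 2)) ^ 2 := by positivity
    linarith
  obtain ⟨i₀, hi₀⟩ := hT.exists_mem_region 0
  -- The longest side of a tile has length at least 1/3; this makes the denominator 5w - 1 below
  -- positive.
  have hw0 : 1 / 3 ≤ w := by
    have h := sum_sideLength (T i₀)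
    rw [hperim, Fin.sum_univ_three] at h
    linarith [hw i₀ 0, hw i₀ 1, hw i₀ 2]
  set N : ℕ → ℝ := fun n => (hF n).toFinset.card with hN
  have hstep : ∀ n, 3 * w * N n ≤ (5 * w - 1) * N (n + 1) := by
    intro n
    have h1 := card_continuingEnds_le hT hF hperim n
    have h2 := three_mul_card_le hF n
    have h3 := mul_card_maximalSides_le hT hF hperim hshare hw n
    have h4 : 3 * N n ≤ (maximalSides hF n).card + 2 * N (n + 1) := by
      simp only [hN]
      push_cast
      exact_mod_cast h2.trans (Nat.add_le_add_left h1 _)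
    have h5 : w * (maximalSides hF n).card ≤ (3 * w - 1) * N (n + 1) := by
      simp only [hN]
      push_cast
      exact h3
    have h6 := mul_le_mul_of_nonneg_left h4 (show 0 ≤ w by linarith)
    linarith
  set ρ := 3 * w / (5 * w - 1) with hρ
  have hden : 0 < 5 * w - 1 := by linarith
  have hρ1 : 1 < ρ := (one_lt_div hden).2 (by linarith)
  have hN0 : 1 ≤ N 0 := by
    have : i₀ ∈ (hF ((0 : ℕ) : ℝ)).toFinset := by
      rw [Set.Finite.mem_toFinset]
      exact ⟨0, hi₀, by simp⟩
    simp only [hN]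
    exact_mod_cast Finset.card_pos.2 ⟨_, this⟩
  have hlow : ∀ n, ρ ^ n ≤ N n := by
    intro n
    induction n with
    | zero => simpa using hN0
    | succ n ih =>
      rw [pow_succ]
      have h1 : N n * ρ ≤ N (n + 1) := by
        rw [hρ, mul_div_assoc', div_le_iff₀ hden]
        linarith [hstep n]
      exact (mul_le_mul_of_nonneg_right ih (by linarith)).trans h1
  set β := volume.real (Metric.ball (0 : Plane) 1) with hβ
  have hup : ∀ n : ℕ, N n * ε ≤ ((n + 1 : ℕ) : ℝ) ^ 2 * β := by
    intro n
    have h := hT.card_mul_le hperim harea (R := n) (hF n).toFinset (by simp)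
    refine h.trans (le_of_eq ?_)
    rw [Measure.real, Measure.addHaar_ball _ _ (by positivity), ENNReal.toReal_mul,
      ENNReal.toReal_ofReal (by positivity)]
    simp [hβ, Measure.real]
  -- The index is shifted to match the radius n + 1 of the packing bound; the extra factor ρ
  -- compensates for the shift in the exponent.
  have hlim := (tendsto_pow_const_div_const_pow_of_one_lt 2 hρ1).comp (tendsto_add_atTop_nat 1)
  have hlim' := (hlim.mul_const β).const_mul ρ
  simp only [zero_mul, mul_zero] at hlim'
  obtain ⟨n, hn⟩ := (hlim'.eventually (gt_mem_nhds hε)).exists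
  simp only [Function.comp] at hn
  have hpow : 0 < ρ ^ n := by positivity
  have h1 := (mul_le_mul_of_nonneg_right (hlow n) hε.le).trans (hup n)
  have h2 : ρ * (((n + 1 : ℕ) : ℝ) ^ 2 / ρ ^ (n + 1) * β) = ((n + 1 : ℕ) : ℝ) ^ 2 * β / ρ ^ n := by
    have : 0 < ρ := by linarith
    field_simp
    ring
  rw [h2, div_lt_iff₀ hpow] at hn
  linarith
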